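/- **Notation.** Let $\Phi_0=\mathbf 1_{[0,1)}$ and $\Phi_p(s)=\frac sp\Phi_{p-1}(s)+\frac{p+1-s}{p}\Phi_{p-1}(s-1)$, $p\ge1$, be the cardinal B-splines. Given $T>0$, $N\ge 1$, $p\ge 1$, let $h=T/N$, let $\varphi^p_0,\dots,\varphi^p_{N+p-1}$ be the B-splines of degree $p$ on $[0,T]$ given by the Cox–de Boor recursion on the open knot vector $\xi_0=\dots=\xi_p=0$, $\xi_{p+\ell}=\ell h$ $(1\le \ell\le N-1)$, $\xi_{p+N}=\dots=\xi_{2p+N}=T$, and define the $n\times n$ matrices, $n=N+p-1$, $$\mathbf M[\ell,j]=\int_0^T\varphi^p_j\,\varphi^p_{\ell-1}\,dt,\qquad \mathbf B[\ell,j]=\int_0^T\partial_t\varphi^p_j\,\partial_t\varphi^p_{\ell-1}\,dt,\qquad \mathbf D[\ell,j]=\int_0^T\partial_t^p\varphi^p_j\,\partial_t^p\varphi^p_{\ell-1}\,dt .$$ For $\rho,\delta\in\mathbb R$ put $\mu=\rho/h^2$ and $\mathbf K^p_n(\rho,\delta)=h\,(-\mathbf B+\mu\mathbf M+\mu\delta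 h^{2p}\mathbf D)$. In the central rows $2p+1\le\ell\le N-p$ these matrices have a Toeplitz band form, $\mathbf K^p_n(\rho,\delta)[\ell,j]=c_{j-\ell}$, with $c_r=0$ unless $-(p+1)\le r\le p-1$, where $c_r$ depends only on $p,\rho,\delta,r$; the associated polynomial is $q^{\mathbf K^p(\rho,\delta)}(z)=\sum_{r=-(p+1)}^{p-1}c_r z^{p+1+r}$. It is given by $$q^{\mathbf K^p(\rho,\delta)}(z)=k_p z^p+\sum_{j=1}^p k_{p-j}\,(z^{p-j}+z^{p+j}),$$ $$k_{p-j}=\partial_s^2\Phi_{2p+1}(p+1-j)+\rho\bigl(\Phi_{2p+1}(p+1-j)+\delta(-1)^p\partial_s^{2p}\Phi_{2p+1}(p+1-j)\bigr),\qquad 0\le j\le p.$$ **Proposition.** Let $p\ge1$ and, for $\theta\in[-\pi,\pi]\setminus\{0\}$, let $$M_p(\theta)=(2-2\cos\theta)^{p+1}\sum_{j\in\mathbb Z}\frac1{(\theta+2j\pi)^{2p+2}},\qquad B_p(\theta)=-(2-2\cos\theta)^{p+1}\sum_{j\in\mathbb Z}\frac1{(\theta+2j\pi)^{2p}}.$$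 The series converge, and $M_p,B_p$ extend continuously to $[-\pi,\pi]$ with $M_p(0)=1$, $B_p(0)=0$. Let $D_p(\theta)=(-1)^p(2-2\cos\theta)^p$. Then for all $\theta\in[-\pi,\pi]$ $$\Phi_{2p+1}(p+1)+\sum_{j=1}^p\Phi_{2p+1}(p+1-j)\,(e^{-\mathrm i j\theta}+e^{\mathrm i j\theta})=M_p(\theta),$$ $$\partial_s^2\Phi_{2p+1}(p+1)+\sum_{j=1}^p\partial_s^2\Phi_{2p+1}(p+1-j)\,(e^{-\mathrm i j\theta}+e^{\mathrm i j\theta})=B_p(\theta),$$ $$\partial_s^{2p}\Phi_{2p+1}(p+1)+\sum_{j=1}^p\partial_s^{2p}\Phi_{2p+1}(p+1-j)\,(e^{-\mathrm i j\theta}+e^{\mathrm i j\theta})=D_p(\theta).$$ Moreover, for all $\rho,\delta\in\mathbb R$, the polynomial associated with the Toeplitz band parts of the matrices $\mathbf K^p_n(\rho,\delta)$ is the $q^{\mathbf K^p(\rho,\delta)}$ displayed above, and for all $\theta\in[-\pi,\pi]$ $$q^{\mathbf K^p(\rho,\delta)}(e^{\mathrm i\theta})=e^{\mathrm i p\theta}\bigl(B_p(\theta)+\rho\,(M_p(\theta)+\delta(-1)^pD_p(\theta))\bigr).$$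 -/

import Mathlib

noncomputable section

open Polynomial

namespace SplineSymbol

/-- The cardinal B-spline of degree `p` over the knots `0, …, p + 1`. -/
def cardinalBSpline : ℕ → ℝ → ℝ
  | 0, s => if 0 ≤ s ∧ s < 1 then 1 else 0
  | p + 1, s =>
      s / ((p : ℝ) + 1) * cardinalBSpline p s
        + ((p : ℝ) + 2 - s) / ((p : ℝ) + 1) * cardinalBSpline p (s - 1)

/-- The uniform mesh size of `[0, T]` with `N` elements. -/
def meshSize (T : ℝ) (N : ℕ) : ℝ := T / N

/-- The open knot vector of maximal regularity: `ξ_0 = … = ξ_p = 0`, `ξ_{p+ℓ} = ℓ h` for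
`1 ≤ ℓ ≤ N - 1`, and `ξ_{p+N} = … = ξ_{2p+N} = T`. Subtraction is truncated in `ℕ`. -/
def knot (T : ℝ) (N p : ℕ) (j : ℕ) : ℝ := meshSize T N * ((min (j - p) N : ℕ) : ℝ)

/-- Cox–de Boor recursion for the B-spline of degree `k` with index `j` on the knots `ξ`.
The usual convention that quotients with denominator `0` vanish is in force. -/
def bspline (ξ : ℕ → ℝ) : ℕ → ℕ → ℝ → ℝ
  | 0, j, t => if ξ j ≤ t ∧ t < ξ (j + 1) then 1 else 0
  | k + 1, j, t =>
      if ξ j ≤ t ∧ t < ξ (j + k + 2) then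
        (t - ξ j) / (ξ (j + k + 1) - ξ j) * bspline ξ k j t
          + (ξ (j + k + 2) - t) / (ξ (j + k + 2) - ξ (j + 1)) * bspline ξ k (j + 1) t
      else 0

/-- The spline basis function `φ_j^p`, `0 ≤ j ≤ N + p - 1`. -/
def splineBasis (T : ℝ) (N p j : ℕ) : ℝ → ℝ := bspline (knot T N p) p j

/-- The matrix with entries `∫_0^T ∂^k φ_j^p ∂^k φ_{ℓ-1}^p` for `1 ≤ ℓ, j ≤ N + p - 1`. The Lean
indices start at `0`, so the row `i` is `ℓ = i + 1` and the column `j` stands for `j + 1`. -/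
def galerkinMatrix (T : ℝ) (N p k : ℕ) : Matrix (Fin (N + p - 1)) (Fin (N + p - 1)) ℝ :=
  fun i j => ∫ t in (0 : ℝ)..T,
    iteratedDeriv k (splineBasis T N p ((j : ℕ) + 1)) t
      * iteratedDeriv k (splineBasis T N p (i : ℕ)) t

/-- Mass matrix. -/
def massMatrix (T : ℝ) (N p : ℕ) : Matrix (Fin (N + p - 1)) (Fin (N + p - 1)) ℝ :=
  galerkinMatrix T N p 0

/-- Stiffness matrix. -/
def stiffnessMatrix (T : ℝ) (N p : ℕ) : Matrix (Fin (N + p - 1)) (Fin (N + p - 1)) ℝ :=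
  galerkinMatrix T N p 1

/-- Matrix of the derivatives of order `p`. -/
def penaltyMatrix (T : ℝ) (N p : ℕ) : Matrix (Fin (N + p - 1)) (Fin (N + p - 1)) ℝ :=
  galerkinMatrix T N p p

/-- The system matrix `-B + μ M + μ δ h^{2p} D` of the stabilized bilinear form. -/
def systemMatrix (T : ℝ) (N p : ℕ) (μ δ : ℝ) :
    Matrix (Fin (N + p - 1)) (Fin (N + p - 1)) ℝ :=
  -stiffnessMatrix T N p + μ • massMatrix T N p
    + (μ * δ * meshSize T N ^ (2 * p)) • penaltyMatrix T N p

/-- The scaled system matrix `K_n^p(ρ, δ)`, `n = N + p - 1`: `h` times the system matrix whose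
parameter `μ` is determined by `ρ = μ h²`. -/
def scaledSystemMatrix (T : ℝ) (N p : ℕ) (ρ δ : ℝ) :
    Matrix (Fin (N + p - 1)) (Fin (N + p - 1)) ℝ :=
  meshSize T N • systemMatrix T N p (ρ / meshSize T N ^ 2) δ

/-- `q` is the polynomial associated with the Toeplitz band part of the family `A`, of lower
bandwidth `p + 1` and upper bandwidth `p - 1`: in the central rows `ℓ = 2p + 1, …, N - p` (that is,
`2p ≤ i` and `i + p + 1 ≤ N` for `ℓ = i + 1`) the entry in position `(i, j)` is `c_{j-i}`, where
`q = ∑ c_r z^{p+1+r}` over `-(p + 1) ≤ r ≤ p - 1`, and `c_r = 0` for all other `r`. -/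
def IsAssociatedPolynomial (p : ℕ)
    (A : ∀ N : ℕ, Matrix (Fin (N + p - 1)) (Fin (N + p - 1)) ℝ) (q : ℝ[X]) : Prop :=
  q.natDegree ≤ 2 * p ∧
    ∀ (N : ℕ) (i j : Fin (N + p - 1)), 2 * p ≤ (i : ℕ) → (i : ℕ) + p + 1 ≤ N →
      A N i j = if (i : ℕ) ≤ (j : ℕ) + p + 1 then q.coeff ((j : ℕ) + p + 1 - (i : ℕ)) else 0

/-- The coefficient `k_i^p(ρ, δ)`, `0 ≤ i ≤ p`. With `i = p - j` the splines are evaluated at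
`p + 1 - j = i + 1`. -/
def kCoeff (p : ℕ) (ρ δ : ℝ) (i : ℕ) : ℝ :=
  iteratedDeriv 2 (cardinalBSpline (2 * p + 1)) ((i : ℝ) + 1)
    + ρ * (cardinalBSpline (2 * p + 1) ((i : ℝ) + 1)
      + δ * (-1) ^ p * iteratedDeriv (2 * p) (cardinalBSpline (2 * p + 1)) ((i : ℝ) + 1))

/-- `k_0 + k_1 z + … + k_p z^p + … + k_1 z^{2p-1} + k_0 z^{2p}`. -/
def qPoly (p : ℕ) (ρ δ : ℝ) : ℝ[X] :=
  C (kCoeff p ρ δ p) * X ^ p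
    + ∑ j ∈ Finset.Icc 1 p, C (kCoeff p ρ δ (p - j)) * (X ^ (p - j) + X ^ (p + j))

/-- `M_p(θ) = (2 - 2 cos θ)^{p+1} ∑_{j ∈ ℤ} (θ + 2jπ)^{-2p-2}` on `[-π, π]`; at `θ = 0`, where the
formula is the indeterminate `0 · ∞`, its limit `1`. -/
def symbolM (p : ℕ) (θ : ℝ) : ℝ :=
  if θ = 0 then 1
  else (2 - 2 * Real.cos θ) ^ (p + 1) * ∑' j : ℤ, 1 / (θ + 2 * j * Real.pi) ^ (2 * p + 2)

/-- `B_p(θ) = -(2 - 2 cos θ)^{p+1} ∑_{j ∈ ℤ} (θ + 2jπ)^{-2p}` on `[-π, π]`; at `θ = 0` its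
limit `0`. -/
def symbolB (p : ℕ) (θ : ℝ) : ℝ :=
  if θ = 0 then 0
  else -(2 - 2 * Real.cos θ) ^ (p + 1) * ∑' j : ℤ, 1 / (θ + 2 * j * Real.pi) ^ (2 * p)

/-- `D_p(θ) = (-1)^p (2 - 2 cos θ)^p`. -/
def symbolD (p : ℕ) (θ : ℝ) : ℝ := (-1) ^ p * (2 - 2 * Real.cos θ) ^ p

/-- The sum `∂^k Φ_{2p+1}(p+1) + ∑_{j=1}^p ∂^k Φ_{2p+1}(p+1-j) (e^{-ijθ} + e^{ijθ})`. -/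
def splineSum (p k : ℕ) (θ : ℝ) : ℂ :=
  ((iteratedDeriv k (cardinalBSpline (2 * p + 1)) ((p : ℝ) + 1) : ℝ) : ℂ)
    + ∑ j ∈ Finset.Icc 1 p,
        ((iteratedDeriv k (cardinalBSpline (2 * p + 1)) ((p : ℝ) + 1 - j) : ℝ) : ℂ)
          * (Complex.exp (-(Complex.I * j * θ)) + Complex.exp (Complex.I * j * θ))

end SplineSymbol

end

/-!
Everything is read off the polynomials `E_{m,k} = ∑ₑ (∂^k Φ_m)(e + 1) X^e`. Since
`Φ_a * Φ_b = Φ_{a+b+1}`, and differentiating a cardinal B-spline takes the backward difference of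
the one of lower degree, the correlation of the `k`-th derivatives of two interior basis functions
is a value of `(-1)^k ∂^{2k} Φ_{2p+1}` at an integer. So the band polynomial of the matrices is a
combination of `E_{2p+1,2}`, `E_{2p+1,0}` and `E_{2p+1,2p}`, and backward differences turn into
`E_{m+k,k} = (1 - X)^k E_{m,0}`. On the unit circle, `Φ̂_m = Φ̂_0^{m+1}` and Poisson summation
express `E_{m,0}` as a sum over `θ + 2πℤ`, while `(1 - e^{iθ})^2 = -(2 - 2 cos θ) e^{iθ}` produces
the powers of `2 - 2 cos θ`.
-/

namespace SplineSymbol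

open MeasureTheory Set Filter Topology FourierTransform Polynomial
open scoped Convolution

/-! ### Backward differences -/

/-- The backward difference `∇f`, in the convention `∇f s = f s - f (s - 1)` of spline theory. -/
def backwardDiff {E : Type*} [Sub E] (f : ℝ → E) : ℝ → E := fun s => f s - f (s - 1)

theorem hasDerivAt_backwardDiff_iterate {E : Type*} [NormedAddCommGroup E] [NormedSpace ℝ E]
    {f f' : ℝ → E} {S : Set ℝ} (hS : ∀ s ∈ S, s - 1 ∈ S)
    (hf : ∀ s ∈ S, HasDerivAt f (f' s) s) (k : ℕ) {s : ℝ} (hs : s ∈ S) :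
    HasDerivAt (backwardDiff^[k] f) (backwardDiff^[k] f' s) s := by
  induction k generalizing s with
  | zero => exact hf s hs
  | succ k ih =>
    rw [Function.iterate_succ_apply', Function.iterate_succ_apply']
    exact (ih hs).sub ((ih (hS s hs)).comp_sub_const s 1)

theorem backwardDiff_iterate_of_nonpos {E : Type*} [AddGroup E] {f : ℝ → E}
    (hf : ∀ s ≤ 0, f s = 0) (k : ℕ) {s : ℝ} (hs : s ≤ 0) : backwardDiff^[k] f s = 0 := by
  induction k generalizing s with
  | zero => exact hf s hs
  | succ k ih =>
    rw [Function.iterate_succ_apply', backwardDiff, ih hs, ih (by linarith), sub_zero]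

theorem sub_one_notMem_range_intCast {s : ℝ} (hs : s ∉ range ((↑) : ℤ → ℝ)) :
    s - 1 ∉ range ((↑) : ℤ → ℝ) := by
  rintro ⟨n, hn⟩
  exact hs ⟨n + 1, by push_cast; linarith⟩

section Convolution

variable {E : Type*} [NormedAddCommGroup E] [NormedSpace ℝ E] {f : ℝ → ℝ} {g : ℝ → E}

theorem convolutionExists_backwardDiff_left (h : ConvolutionExists f g (.lsmul ℝ ℝ)) :
    ConvolutionExists (backwardDiff f) g (.lsmul ℝ ℝ) := fun x => by
  refine ((h x).sub ((h (x - 1)).comp_sub_right 1)).congr (ae_of_all _ fun t => ?_)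
  simp only [backwardDiff, map_sub, sub_apply, Pi.sub_apply]
  ring_nf

theorem convolutionExists_backwardDiff_right (h : ConvolutionExists f g (.lsmul ℝ ℝ)) :
    ConvolutionExists f (backwardDiff g) (.lsmul ℝ ℝ) := fun x => by
  refine ((h x).sub (h (x - 1))).congr (ae_of_all _ fun t => ?_)
  simp only [backwardDiff, map_sub, Pi.sub_apply]
  ring_nf

theorem backwardDiff_convolution (h : ConvolutionExists f g (.lsmul ℝ ℝ)) :
    backwardDiff f ⋆ g = backwardDiff (f ⋆ g) := by
  ext x
  simp only [backwardDiff, convolution_def, map_sub, sub_apply]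
  rw [← integral_sub_right_eq_self (fun t => ContinuousLinearMap.lsmul ℝ ℝ (f t) (g (x - 1 - t))) 1,
    ← integral_sub (h x) ((h (x - 1)).comp_sub_right 1)]
  simp only [sub_sub_sub_cancel_right]

theorem convolution_backwardDiff (h : ConvolutionExists f g (.lsmul ℝ ℝ)) :
    f ⋆ backwardDiff g = backwardDiff (f ⋆ g) := by
  ext x
  simp only [backwardDiff, convolution_def, map_sub]
  rw [← integral_sub (h x) (h (x - 1))]
  simp only [sub_right_comm]

theorem backwardDiff_iterate_convolution (h : ConvolutionExists f g (.lsmul ℝ ℝ)) (k l : ℕ) :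
    backwardDiff^[k] f ⋆ backwardDiff^[l] g = backwardDiff^[k + l] (f ⋆ g) := by
  induction k generalizing f with
  | zero =>
    induction l generalizing g with
    | zero => rfl
    | succ l ih =>
      rw [Function.iterate_succ_apply, ih (convolutionExists_backwardDiff_right h),
        ← add_assoc, Function.iterate_succ_apply]
      exact congrArg _ (convolution_backwardDiff h)
  | succ k ih =>
    rw [Function.iterate_succ_apply, ih (convolutionExists_backwardDiff_left h),
      backwardDiff_convolution h, add_right_comm, Function.iterate_succ_apply]

theorem convolution_assoc_of_bounded [CompleteSpace E] {f g : ℝ → ℝ} {u : ℝ → E}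
    (hf : Integrable f) (hg : Integrable g) (hu : AEStronglyMeasurable u) {c : ℝ}
    (hc : ∀ x, ‖u x‖ ≤ c) : (f ⋆ g) ⋆ u = f ⋆ (g ⋆ u) := by
  have hgu : ∀ x, ConvolutionExistsAt (‖g ·‖) (‖u ·‖) x (.mul ℝ ℝ) := fun x =>
    hg.norm.mul_bdd (hu.norm.comp_quasiMeasurePreserving
      (quasiMeasurePreserving_sub_left volume x)) (ae_of_all _ fun t => by simpa using hc (x - t))
  have hgu_meas : AEStronglyMeasurable ((‖g ·‖) ⋆[.mul ℝ ℝ] (‖u ·‖)) :=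
    (hg.norm.aestronglyMeasurable.convolution_integrand (.mul ℝ ℝ) hu.norm).integral_prod_right'
  have hgu_le : ∀ x, ‖((‖g ·‖) ⋆[.mul ℝ ℝ] (‖u ·‖)) x‖ ≤ (∫ t, ‖g t‖) * c := fun x => by
    rw [convolution_mul, ← integral_mul_const]
    refine (norm_integral_le_integral_norm _).trans (integral_mono (hgu x).norm
      (hg.norm.mul_const c) fun t => ?_)
    simpa using mul_le_mul_of_nonneg_left (hc (x - t)) (norm_nonneg (g t))
  ext x
  refine convolution_assoc (.lsmul ℝ ℝ) (.lsmul ℝ ℝ) (.lsmul ℝ ℝ) (.lsmul ℝ ℝ)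
    (fun a b v => smul_assoc a b v) hf.1 hg.1 hu (hf.ae_convolution_exists _ hg)
    (ae_of_all _ hgu) ?_
  exact hf.norm.mul_bdd (hgu_meas.comp_quasiMeasurePreserving
    (quasiMeasurePreserving_sub_left volume x)) (ae_of_all _ fun t => hgu_le (x - t))

end Convolution

/-! ### Cardinal B-splines -/

theorem cardinalBSpline_zero : cardinalBSpline 0 = indicator (Ico 0 1) 1 := by
  ext s
  simp only [cardinalBSpline, indicator_apply, mem_Ico, Pi.one_apply]

theorem cardinalBSpline_succ_apply (m : ℕ) (s : ℝ) :
    cardinalBSpline (m + 1) s = s / ((m : ℝ) + 1) * cardinalBSpline m s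
      + ((m : ℝ) + 2 - s) / ((m : ℝ) + 1) * cardinalBSpline m (s - 1) := rfl

theorem cardinalBSpline_of_neg (m : ℕ) {s : ℝ} (hs : s < 0) : cardinalBSpline m s = 0 := by
  induction m generalizing s with
  | zero => rw [cardinalBSpline_zero, indicator_of_notMem fun h => hs.not_ge h.1]
  | succ m ih =>
    rw [cardinalBSpline_succ_apply, ih hs, ih (by linarith), mul_zero, mul_zero, add_zero]

theorem cardinalBSpline_of_ge (m : ℕ) {s : ℝ} (hs : (m : ℝ) + 1 ≤ s) :
    cardinalBSpline m s = 0 := by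
  induction m generalizing s with
  | zero =>
    rw [cardinalBSpline_zero, indicator_of_notMem fun h => h.2.not_ge (by simpa using hs)]
  | succ m ih =>
    push_cast at hs
    rw [cardinalBSpline_succ_apply, ih (by linarith), ih (by linarith), mul_zero, mul_zero,
      add_zero]

theorem cardinalBSpline_succ_of_nonpos (m : ℕ) {s : ℝ} (hs : s ≤ 0) :
    cardinalBSpline (m + 1) s = 0 := by
  rw [cardinalBSpline_succ_apply, cardinalBSpline_of_neg m (s := s - 1) (by linarith), mul_zero,
    add_zero]
  rcases hs.lt_or_eq with h | rfl
  · rw [cardinalBSpline_of_neg m h, mul_zero]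
  · rw [zero_div, zero_mul]

theorem support_cardinalBSpline_subset (m : ℕ) :
    Function.support (cardinalBSpline m) ⊆ Icc 0 ((m : ℝ) + 1) := fun s hs => by
  by_contra h
  rw [mem_Icc, not_and_or, not_le, not_le] at h
  exact hs (h.elim (cardinalBSpline_of_neg m) fun h => cardinalBSpline_of_ge m h.le)

theorem hasCompactSupport_cardinalBSpline (m : ℕ) : HasCompactSupport (cardinalBSpline m) :=
  .of_support_subset_isCompact isCompact_Icc (support_cardinalBSpline_subset m)

theorem cardinalBSpline_one_apply (s : ℝ) : cardinalBSpline 1 s = max 0 (min s (2 - s)) := by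
  simp only [cardinalBSpline]
  grind

theorem continuous_cardinalBSpline_succ (m : ℕ) : Continuous (cardinalBSpline (m + 1)) := by
  induction m with
  | zero =>
    rw [funext cardinalBSpline_one_apply]
    fun_prop
  | succ m ih =>
    rw [funext (cardinalBSpline_succ_apply (m + 1))]
    fun_prop

theorem integrable_cardinalBSpline (m : ℕ) : Integrable (cardinalBSpline m) := by
  cases m with
  | zero =>
    rw [cardinalBSpline_zero, integrable_indicator_iff measurableSet_Ico]
    exact integrableOn_const (by simp)
  | succ m =>
    exact (continuous_cardinalBSpline_succ m).integrable_of_hasCompactSupport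
      (hasCompactSupport_cardinalBSpline _)

theorem exists_norm_cardinalBSpline_le (m : ℕ) : ∃ c : ℝ, ∀ s, ‖cardinalBSpline m s‖ ≤ c := by
  cases m with
  | zero =>
    rw [cardinalBSpline_zero]
    exact ⟨1, fun s => (norm_indicator_le_norm_self 1 s).trans_eq norm_one⟩
  | succ m =>
    exact (continuous_cardinalBSpline_succ m).bounded_above_of_compact_support
      (hasCompactSupport_cardinalBSpline _)

theorem hasDerivAt_cardinalBSpline_zero {s : ℝ} (hs : s ∉ range ((↑) : ℤ → ℝ)) :
    HasDerivAt (cardinalBSpline 0) 0 s := by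
  have hs' : s ∈ (frontier (Ico (0 : ℝ) 1))ᶜ := by
    rw [frontier_Ico zero_lt_one]
    rintro (rfl | rfl)
    exacts [hs ⟨0, Int.cast_zero⟩, hs ⟨1, Int.cast_one⟩]
  rw [compl_frontier_eq_union_interior] at hs'
  rw [cardinalBSpline_zero]
  rcases hs' with h | h
  · refine (hasDerivAt_const s (1 : ℝ)).congr_of_eventuallyEq ?_
    filter_upwards [mem_interior_iff_mem_nhds.1 h] with t ht using indicator_of_mem ht _
  · refine (hasDerivAt_const s (0 : ℝ)).congr_of_eventuallyEq ?_
    filter_upwards [mem_interior_iff_mem_nhds.1 h] with t ht using indicator_of_notMem ht _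

theorem hasDerivAt_cardinalBSpline_succ_of_notMem (m : ℕ) {s : ℝ}
    (hs : s ∉ range ((↑) : ℤ → ℝ)) :
    HasDerivAt (cardinalBSpline (m + 1)) (backwardDiff (cardinalBSpline m) s) s := by
  have hasDerivAt_succ {m : ℕ} {s a b : ℝ} (ha : HasDerivAt (cardinalBSpline m) a s)
      (hb : HasDerivAt (cardinalBSpline m) b (s - 1)) :
      HasDerivAt (cardinalBSpline (m + 1))
        (1 / ((m : ℝ) + 1) * cardinalBSpline m s + s / ((m : ℝ) + 1) * a
          + (-1 / ((m : ℝ) + 1) * cardinalBSpline m (s - 1)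
            + ((m : ℝ) + 2 - s) / ((m : ℝ) + 1) * b)) s :=
    (((hasDerivAt_id s).div_const _).mul ha).add
      ((((hasDerivAt_id s).const_sub _).div_const _).mul (hb.comp_sub_const s 1))
  induction m generalizing s with
  | zero =>
    refine (hasDerivAt_succ (hasDerivAt_cardinalBSpline_zero hs)
      (hasDerivAt_cardinalBSpline_zero (sub_one_notMem_range_intCast hs))).congr_deriv ?_
    rw [backwardDiff, Nat.cast_zero]
    ring
  | succ m ih =>
    refine (hasDerivAt_succ (ih hs) (ih (sub_one_notMem_range_intCast hs))).congr_deriv ?_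
    simp only [backwardDiff, cardinalBSpline_succ_apply]
    push_cast
    field_simp
    ring

theorem integral_backwardDiff_cardinalBSpline (m : ℕ) (x : ℝ) :
    ∫ t in (0 : ℝ)..x, backwardDiff (cardinalBSpline m) t = cardinalBSpline (m + 1) x := by
  have hint : Integrable (backwardDiff (cardinalBSpline m)) :=
    (integrable_cardinalBSpline m).sub ((integrable_cardinalBSpline m).comp_sub_right 1)
  rw [integral_eq_of_hasDerivAt_off_countable (cardinalBSpline (m + 1)) _
    (countable_range ((↑) : ℤ → ℝ)) (continuous_cardinalBSpline_succ m).continuousOn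
    (fun s hs => hasDerivAt_cardinalBSpline_succ_of_notMem m hs.2) hint.intervalIntegrable,
    cardinalBSpline_succ_of_nonpos m le_rfl, sub_zero]

theorem hasDerivAt_cardinalBSpline_add_two (m : ℕ) (s : ℝ) :
    HasDerivAt (cardinalBSpline (m + 2)) (backwardDiff (cardinalBSpline (m + 1)) s) s := by
  have hc : Continuous (backwardDiff (cardinalBSpline (m + 1))) :=
    (continuous_cardinalBSpline_succ m).sub
      ((continuous_cardinalBSpline_succ m).comp (continuous_sub_right 1))
  rw [← funext (integral_backwardDiff_cardinalBSpline (m + 1))]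
  exact (hc.integral_hasStrictDerivAt 0 s).hasDerivAt

theorem iteratedDeriv_cardinalBSpline (k m : ℕ) :
    iteratedDeriv k (cardinalBSpline (m + 1 + k)) = backwardDiff^[k] (cardinalBSpline (m + 1)) := by
  induction k generalizing m with
  | zero => rw [iteratedDeriv_zero, add_zero, Function.iterate_zero, id]
  | succ k ih =>
    rw [iteratedDeriv_succ, ← add_assoc, add_right_comm, ih (m + 1), Function.iterate_succ_apply]
    ext s
    exact (hasDerivAt_backwardDiff_iterate (fun s _ => mem_univ (s - 1))
      (fun s _ => hasDerivAt_cardinalBSpline_add_two m s) k (mem_univ s)).deriv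

theorem iteratedDeriv_succ_cardinalBSpline {k m : ℕ} (hk : k ≤ m) :
    iteratedDeriv (k + 1) (cardinalBSpline (m + 2))
      = backwardDiff (iteratedDeriv k (cardinalBSpline (m + 1))) := by
  obtain ⟨r, rfl⟩ := Nat.exists_eq_add_of_le' hk
  rw [show r + k + 2 = r + 1 + (k + 1) by ring, iteratedDeriv_cardinalBSpline, add_right_comm,
    iteratedDeriv_cardinalBSpline, Function.iterate_succ_apply']

theorem iteratedDeriv_cardinalBSpline_of_notMem (k m : ℕ) {s : ℝ}
    (hs : s ∉ range ((↑) : ℤ → ℝ)) :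
    iteratedDeriv k (cardinalBSpline (m + k)) s = backwardDiff^[k] (cardinalBSpline m) s := by
  rcases m with _ | m
  · rcases k with _ | k
    · simp
    rw [iteratedDeriv_succ, ← add_assoc, add_right_comm, iteratedDeriv_cardinalBSpline,
      Function.iterate_succ_apply]
    exact (hasDerivAt_backwardDiff_iterate (S := (range ((↑) : ℤ → ℝ))ᶜ)
      (fun _ => sub_one_notMem_range_intCast)
      (fun _ => hasDerivAt_cardinalBSpline_succ_of_notMem 0) k hs).deriv
  · rw [iteratedDeriv_cardinalBSpline]

theorem cardinalBSpline_sub_self_of_notMem (m : ℕ) {s : ℝ} (hs : s ∉ range ((↑) : ℤ → ℝ)) :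
    cardinalBSpline m ((m : ℝ) + 1 - s) = cardinalBSpline m s := by
  induction m generalizing s with
  | zero =>
    have h0 : s ≠ 0 := fun h => hs ⟨0, by simp [h]⟩
    have h1 : s ≠ 1 := fun h => hs ⟨1, by simp [h]⟩
    simp only [cardinalBSpline]
    grind
  | succ m ih =>
    rw [cardinalBSpline_succ_apply, cardinalBSpline_succ_apply, ← ih hs,
      ← ih (sub_one_notMem_range_intCast hs)]
    push_cast
    ring_nf

/-- The half-open convention in `Φ_0` rules out degree `0`. -/
theorem cardinalBSpline_succ_sub_self (m : ℕ) (s : ℝ) :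
    cardinalBSpline (m + 1) ((m : ℝ) + 2 - s) = cardinalBSpline (m + 1) s := by
  have hdense : Dense (range ((↑) : ℤ → ℝ))ᶜ := (countable_range _).dense_compl ℝ
  refine congrFun (Continuous.ext_on hdense
    ((continuous_cardinalBSpline_succ m).comp (continuous_sub_left ((m : ℝ) + 2)))
    (continuous_cardinalBSpline_succ m) fun t ht => ?_) s
  have h := cardinalBSpline_sub_self_of_notMem (m + 1) ht
  rwa [Nat.cast_succ, add_assoc, one_add_one_eq_two] at h

theorem iteratedDeriv_cardinalBSpline_succ_sub_self (k m : ℕ) (s : ℝ) :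
    iteratedDeriv k (cardinalBSpline (m + 1)) ((m : ℝ) + 2 - s)
      = (-1) ^ k * iteratedDeriv k (cardinalBSpline (m + 1)) s := by
  have h := congrFun (iteratedDeriv_comp_const_sub k (cardinalBSpline (m + 1)) ((m : ℝ) + 2)) s
  rw [funext (cardinalBSpline_succ_sub_self m)] at h
  rw [h, smul_eq_mul, ← mul_assoc, ← mul_pow, neg_mul_neg, one_mul, one_pow, one_mul]

theorem iteratedDeriv_cardinalBSpline_of_nonpos {k m : ℕ} (hk : k ≤ m) {s : ℝ} (hs : s ≤ 0) :
    iteratedDeriv k (cardinalBSpline (m + 1)) s = 0 := by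
  obtain ⟨r, rfl⟩ := Nat.exists_eq_add_of_le' hk
  rw [add_right_comm, iteratedDeriv_cardinalBSpline]
  exact backwardDiff_iterate_of_nonpos (fun s => cardinalBSpline_succ_of_nonpos r) k hs

theorem iteratedDeriv_cardinalBSpline_of_ge {k m : ℕ} (hk : k ≤ m) {s : ℝ}
    (hs : (m : ℝ) + 2 ≤ s) : iteratedDeriv k (cardinalBSpline (m + 1)) s = 0 := by
  rw [← sub_sub_cancel ((m : ℝ) + 2) s, iteratedDeriv_cardinalBSpline_succ_sub_self,
    iteratedDeriv_cardinalBSpline_of_nonpos hk (sub_nonpos.2 hs), mul_zero]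

theorem cardinalBSpline_zero_convolution_apply {E : Type*} [NormedAddCommGroup E]
    [NormedSpace ℝ E] (g : ℝ → E) (x : ℝ) :
    (cardinalBSpline 0 ⋆ g) x = ∫ u in (0 : ℝ)..1, g (x - u) := by
  rw [convolution_lsmul, intervalIntegral.integral_of_le zero_le_one, integral_Ioc_eq_integral_Ioo,
    ← integral_Ico_eq_integral_Ioo, ← integral_indicator measurableSet_Ico, cardinalBSpline_zero]
  congr 1 with u
  by_cases hu : u ∈ Ico (0 : ℝ) 1 <;> simp [hu]

theorem cardinalBSpline_zero_convolution_cardinalBSpline (m : ℕ) :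
    cardinalBSpline 0 ⋆ cardinalBSpline m = cardinalBSpline (m + 1) := by
  ext x
  have hi : ∀ a b, IntervalIntegrable (cardinalBSpline m) volume a b := fun a b =>
    (integrable_cardinalBSpline m).intervalIntegrable
  have hneg : ∫ t in (-1 : ℝ)..0, cardinalBSpline m t = 0 := by
    rw [intervalIntegral.integral_of_le (by norm_num), integral_Ioc_eq_integral_Ioo]
    exact setIntegral_eq_zero_of_forall_eq_zero fun t ht => cardinalBSpline_of_neg m ht.2
  rw [cardinalBSpline_zero_convolution_apply, ← integral_backwardDiff_cardinalBSpline,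
    intervalIntegral.integral_comp_sub_left (cardinalBSpline m), sub_zero]
  simp only [backwardDiff]
  rw [intervalIntegral.integral_sub (hi _ _)
    ((integrable_cardinalBSpline m).comp_sub_right 1).intervalIntegrable,
    intervalIntegral.integral_comp_sub_right (cardinalBSpline m), zero_sub,
    intervalIntegral.integral_interval_sub_interval_comm' (hi _ _) (hi _ _) (hi _ _), hneg]
  simp

theorem cardinalBSpline_convolution_cardinalBSpline (a b : ℕ) :
    cardinalBSpline a ⋆ cardinalBSpline b = cardinalBSpline (a + b + 1) := by
  induction a with
  | zero => rw [cardinalBSpline_zero_convolution_cardinalBSpline, zero_add]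
  | succ a ih =>
    obtain ⟨c, hc⟩ := exists_norm_cardinalBSpline_le b
    rw [← cardinalBSpline_zero_convolution_cardinalBSpline, convolution_assoc_of_bounded
      (integrable_cardinalBSpline 0) (integrable_cardinalBSpline a)
      (integrable_cardinalBSpline b).aestronglyMeasurable hc, ih,
      cardinalBSpline_zero_convolution_cardinalBSpline, add_right_comm a 1 b]

theorem convolutionExists_cardinalBSpline (a b : ℕ) :
    ConvolutionExists (cardinalBSpline a) (cardinalBSpline b) (.lsmul ℝ ℝ) := fun x => by
  obtain ⟨c, hc⟩ := exists_norm_cardinalBSpline_le b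
  exact (integrable_cardinalBSpline a).mul_bdd
    ((integrable_cardinalBSpline b).comp_sub_left x).aestronglyMeasurable
    (ae_of_all _ fun t => hc (x - t))

/-! ### Euler–Frobenius polynomials -/

/-- The polynomial `∑ (∂^k Φ_m)(e + 1) X^e` collecting the values of `∂^k Φ_m` at the interior knots
`1, …, m`. For `k = 0` it is the Euler–Frobenius polynomial, up to the factor `m!`. -/
noncomputable def eulerFrobenius (m k : ℕ) : ℝ[X] :=
  ∑ e ∈ Finset.range m, C (iteratedDeriv k (cardinalBSpline m) (e + 1)) * X ^ e

theorem coeff_eulerFrobenius {m k : ℕ} (hk : k ≤ m) (e : ℕ) :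
    (eulerFrobenius (m + 1) k).coeff e = iteratedDeriv k (cardinalBSpline (m + 1)) (e + 1) := by
  simp only [eulerFrobenius, finsetSum_coeff, coeff_C_mul_X_pow, Finset.sum_ite_eq,
    Finset.mem_range, ite_eq_left_iff, not_lt]
  intro he
  have he' : (m : ℝ) + 1 ≤ e := by exact_mod_cast he
  exact (iteratedDeriv_cardinalBSpline_of_ge hk (by linarith)).symm

theorem natDegree_eulerFrobenius_succ_le (m k : ℕ) : (eulerFrobenius (m + 1) k).natDegree ≤ m :=
  natDegree_sum_le_of_forall_le _ _ fun _ he =>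
    (natDegree_C_mul_X_pow_le _ _).trans (Finset.mem_range_succ_iff.1 he)

theorem eulerFrobenius_one_zero : eulerFrobenius 1 0 = 1 := by
  rw [eulerFrobenius, Finset.sum_range_one, iteratedDeriv_zero, cardinalBSpline_one_apply]
  norm_num

theorem eulerFrobenius_succ_succ {m k : ℕ} (hk : k ≤ m) :
    eulerFrobenius (m + 2) (k + 1) = (1 - X) * eulerFrobenius (m + 1) k := by
  ext e
  rw [coeff_eulerFrobenius (by omega), iteratedDeriv_succ_cardinalBSpline hk, backwardDiff,
    sub_mul, one_mul, coeff_sub, coeff_eulerFrobenius hk, add_sub_cancel_right]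
  congr 1
  cases e with
  | zero => simp [iteratedDeriv_cardinalBSpline_of_nonpos hk le_rfl]
  | succ e => rw [coeff_X_mul, coeff_eulerFrobenius hk, Nat.cast_succ]

theorem eulerFrobenius_add (m k : ℕ) :
    eulerFrobenius (m + 1 + k) k = (1 - X) ^ k * eulerFrobenius (m + 1) 0 := by
  induction k with
  | zero => rw [add_zero, pow_zero, one_mul]
  | succ k ih =>
    rw [pow_succ', mul_assoc, ← ih, add_right_comm m 1 k,
      ← eulerFrobenius_succ_succ (Nat.le_add_left k m)]
    congr 1
    ring

theorem sum_range_two_mul_add_one {M : Type*} [AddCommMonoid M] (f : ℕ → M) (p : ℕ) :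
    ∑ e ∈ Finset.range (2 * p + 1), f e
      = f p + ∑ j ∈ Finset.Icc 1 p, (f (p - j) + f (p + j)) := by
  have sum_Ico (q : ℕ) (hq : q ≤ p) : ∑ e ∈ Finset.Ico (p - q) (p + q + 1), f e
      = f p + ∑ j ∈ Finset.Icc 1 q, (f (p - j) + f (p + j)) := by
    induction q with
    | zero => simp
    | succ q ih =>
      rw [Finset.sum_Icc_succ_top (by omega), ← add_assoc (f p), ← ih (by omega),
        Finset.sum_eq_sum_Ico_succ_bot (by omega), show p - (q + 1) + 1 = p - q by omega,
        ← add_assoc p q 1, Finset.sum_Ico_succ_top (by omega), add_left_comm]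
  rw [← sum_Ico p le_rfl, Nat.sub_self, ← two_mul, Finset.range_eq_Ico]

theorem eulerFrobenius_eq_add_sum {k : ℕ} (hk : Even k) (p : ℕ) :
    eulerFrobenius (2 * p + 1) k
      = C (iteratedDeriv k (cardinalBSpline (2 * p + 1)) (p + 1)) * X ^ p
        + ∑ j ∈ Finset.Icc 1 p,
          C (iteratedDeriv k (cardinalBSpline (2 * p + 1)) ((p - j : ℕ) + 1))
            * (X ^ (p - j) + X ^ (p + j)) := by
  rw [eulerFrobenius, sum_range_two_mul_add_one]
  congr 1
  refine Finset.sum_congr rfl fun j hj => ?_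
  have hsymm := iteratedDeriv_cardinalBSpline_succ_sub_self k (2 * p) ((p + j : ℕ) + 1)
  rw [hk.neg_one_pow, one_mul] at hsymm
  rw [mul_add, ← hsymm, Nat.cast_sub (Finset.mem_Icc.1 hj).2]
  push_cast
  ring_nf

theorem qPoly_eq (p : ℕ) (ρ δ : ℝ) :
    qPoly p ρ δ = eulerFrobenius (2 * p + 1) 2 + C ρ * (eulerFrobenius (2 * p + 1) 0
      + C (δ * (-1) ^ p) * eulerFrobenius (2 * p + 1) (2 * p)) := by
  simp only [qPoly, kCoeff, eulerFrobenius_eq_add_sum even_two, eulerFrobenius_eq_add_sum Even.zero,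
    eulerFrobenius_eq_add_sum (even_two_mul p), iteratedDeriv_zero, C_add, C_mul, add_mul,
    Finset.sum_add_distrib, mul_add, Finset.mul_sum, mul_assoc]
  abel

theorem aeval_eulerFrobenius_eq_splineSum {k : ℕ} (hk : Even k) (p : ℕ) (θ : ℝ) :
    aeval (Complex.exp (Complex.I * θ)) (eulerFrobenius (2 * p + 1) k)
      = Complex.exp (Complex.I * p * θ) * splineSum p k θ := by
  rw [eulerFrobenius_eq_add_sum hk, splineSum, map_add, map_sum, mul_add, Finset.mul_sum]
  simp only [map_mul, map_add, map_pow, aeval_C, aeval_X, Complex.coe_algebraMap,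
    ← Complex.exp_nat_mul]
  congr 1
  · rw [mul_comm]
    ring_nf
  refine Finset.sum_congr rfl fun j hj => ?_
  rw [mul_left_comm (Complex.exp _), mul_add (Complex.exp _), ← Complex.exp_add, ← Complex.exp_add,
    Nat.cast_sub (Finset.mem_Icc.1 hj).2, Nat.cast_sub (Finset.mem_Icc.1 hj).2]
  push_cast
  ring_nf

/-! ### Poisson summation -/

/-- The Fourier transform `∫₀¹ e^{-iωu} du` of `Φ_0`, in the angular frequency `ω`. -/
noncomputable def boxTransform (ω : ℝ) : ℂ :=
  ∫ u in (0 : ℝ)..1, Complex.exp (-(Complex.I * ω) * u)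

theorem boxTransform_zero : boxTransform 0 = 1 := by simp [boxTransform]

theorem boxTransform_of_ne_zero {ω : ℝ} (hω : ω ≠ 0) :
    boxTransform ω = (1 - Complex.exp (-(Complex.I * ω))) / (Complex.I * ω) := by
  have h : Complex.I * (ω : ℂ) ≠ 0 :=
    mul_ne_zero Complex.I_ne_zero (Complex.ofReal_ne_zero.2 hω)
  rw [boxTransform, integral_exp_mul_complex (neg_ne_zero.2 h), Complex.ofReal_one,
    Complex.ofReal_zero, mul_one, mul_zero, Complex.exp_zero, div_neg, ← neg_div, neg_sub]

theorem norm_boxTransform_le {ω : ℝ} (hω : ω ≠ 0) : ‖boxTransform ω‖ ≤ 2 / |ω| := by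
  rw [boxTransform_of_ne_zero hω, norm_div, norm_mul, Complex.norm_I, one_mul, Complex.norm_real,
    Real.norm_eq_abs]
  gcongr
  refine (norm_sub_le _ _).trans_eq ?_
  rw [norm_one, Complex.norm_exp]
  norm_num

theorem cardinalBSpline_zero_convolution_exp (ω : ℝ) :
    (cardinalBSpline 0 ⋆ fun x : ℝ => Complex.exp (Complex.I * ω * x))
      = boxTransform ω • fun x : ℝ => Complex.exp (Complex.I * ω * x) := by
  ext x
  rw [cardinalBSpline_zero_convolution_apply, Pi.smul_apply, smul_eq_mul, boxTransform,
    ← intervalIntegral.integral_mul_const]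
  congr 1 with u
  rw [← Complex.exp_add]
  push_cast
  ring_nf

theorem cardinalBSpline_convolution_exp (m : ℕ) (ω : ℝ) :
    (cardinalBSpline m ⋆ fun x : ℝ => Complex.exp (Complex.I * ω * x))
      = boxTransform ω ^ (m + 1) • fun x : ℝ => Complex.exp (Complex.I * ω * x) := by
  induction m with
  | zero => rw [cardinalBSpline_zero_convolution_exp, zero_add, pow_one]
  | succ m ih =>
    have hcont : Continuous fun x : ℝ => Complex.exp (Complex.I * ω * x) := by fun_prop
    rw [← cardinalBSpline_zero_convolution_cardinalBSpline, convolution_assoc_of_bounded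
      (integrable_cardinalBSpline 0) (integrable_cardinalBSpline m)
      hcont.aestronglyMeasurable (c := 1) (fun x => by simp [Complex.norm_exp]), ih]
    ext x
    rw [cardinalBSpline_zero_convolution_apply]
    simp only [Pi.smul_apply]
    rw [intervalIntegral.integral_smul, ← cardinalBSpline_zero_convolution_apply
      (fun x : ℝ => Complex.exp (Complex.I * ω * x)), cardinalBSpline_zero_convolution_exp,
      Pi.smul_apply, smul_smul, ← pow_succ]

theorem integral_cardinalBSpline_smul_exp (m : ℕ) (ω : ℝ) :
    ∫ x : ℝ, cardinalBSpline m x • Complex.exp (-(Complex.I * ω) * x)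
      = boxTransform ω ^ (m + 1) := by
  have h := congrFun (cardinalBSpline_convolution_exp m ω) 0
  simpa [convolution_lsmul] using h

theorem summable_one_div_add_two_mul_int_mul_pi_pow (θ : ℝ) {k : ℕ} (hk : 2 ≤ k) :
    Summable fun j : ℤ => 1 / (θ + 2 * j * Real.pi) ^ k := by
  have h := (Real.summable_one_div_int_add_rpow (θ / (2 * Real.pi)) k).2 (by exact_mod_cast hk)
  refine Summable.of_norm_bounded (h.mul_left (1 / (2 * Real.pi) ^ k)) fun j => le_of_eq ?_
  have hj : θ + 2 * j * Real.pi = 2 * Real.pi * (j + θ / (2 * Real.pi)) := by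
    field_simp
    ring
  rw [Real.rpow_natCast, norm_div, norm_one, norm_pow, Real.norm_eq_abs, div_mul_div_comm, one_mul,
    hj, abs_mul, abs_of_pos Real.two_pi_pos, mul_pow]

theorem summable_boxTransform_pow (θ : ℝ) {k : ℕ} (hk : 2 ≤ k) :
    Summable fun n : ℤ => boxTransform (2 * Real.pi * n - θ) ^ k := by
  have hsum := (summable_one_div_add_two_mul_int_mul_pi_pow (-θ) hk).norm.mul_left (2 ^ k)
  refine hsum.of_norm_bounded_eventually ?_
  have hfinite : {n : ℤ | 2 * Real.pi * n - θ = 0}.Finite := by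
    refine Set.Subsingleton.finite fun a (ha : _ = 0) b (hb : _ = 0) => ?_
    have := mul_left_cancel₀ Real.two_pi_pos.ne' ((sub_eq_zero.1 ha).trans (sub_eq_zero.1 hb).symm)
    exact_mod_cast this
  filter_upwards [hfinite.compl_mem_cofinite] with n hn
  have h := pow_le_pow_left₀ (norm_nonneg _) (norm_boxTransform_le hn) k
  rwa [norm_pow, norm_div, norm_one, norm_pow, mul_one_div, ← div_pow, Real.norm_eq_abs,
    show -θ + 2 * n * Real.pi = 2 * Real.pi * n - θ by ring]

theorem tsum_cardinalBSpline_mul_exp_zpow (m : ℕ) (θ : ℝ) :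
    ∑' n : ℤ, (cardinalBSpline (m + 1) n : ℂ) * Complex.exp (Complex.I * θ) ^ n
      = ∑' n : ℤ, boxTransform (2 * Real.pi * n - θ) ^ (m + 2) := by
  set f : ℝ → ℂ := fun x => cardinalBSpline (m + 1) x * Complex.exp (Complex.I * θ * x) with hf
  have hcont : Continuous f := by
    have := continuous_cardinalBSpline_succ m
    fun_prop
  have hfourier (n : ℤ) : 𝓕 f n = boxTransform (2 * Real.pi * n - θ) ^ (m + 2) := by
    rw [← integral_cardinalBSpline_smul_exp (m + 1), Real.fourier_real_eq_integral_exp_smul]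
    congr 1 with x
    rw [hf, smul_eq_mul, Complex.real_smul, mul_left_comm, ← Complex.exp_add]
    congr 2
    push_cast
    ring
  have hdecay : f =O[cocompact ℝ] fun x : ℝ => |x| ^ (-2 : ℝ) := by
    refine EventuallyEq.trans_isBigO (f₂ := fun _ => (0 : ℂ)) ?_ (Asymptotics.isBigO_zero _ _)
    filter_upwards [(hasCompactSupport_cardinalBSpline (m + 1)).isCompact.compl_mem_cocompact]
      with x hx
    simp only [hf, image_eq_zero_of_notMem_tsupport hx, Complex.ofReal_zero, zero_mul]
  have h := Real.tsum_eq_tsum_fourier_of_rpow_decay_of_summable hcont one_lt_two hdecay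
    (by simpa only [hfourier] using summable_boxTransform_pow θ (Nat.le_add_left 2 m)) 0
  simp only [hfourier, QuotientAddGroup.mk_zero, fourier_eval_zero, mul_one, zero_add] at h
  rw [← h]
  congr 1 with n
  simp only [hf, ← Complex.exp_int_mul, mul_comm (n : ℂ), Complex.ofReal_intCast]

theorem mul_aeval_eulerFrobenius_zero (m : ℕ) (z : ℂ) :
    z * aeval z (eulerFrobenius (m + 1) 0) = ∑' n : ℤ, (cardinalBSpline (m + 1) n : ℂ) * z ^ n := by
  rw [tsum_eq_sum (s := (Finset.range (m + 1)).image fun e : ℕ => (e : ℤ) + 1),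
    Finset.sum_image (by simp), eulerFrobenius, map_sum, Finset.mul_sum]
  · refine Finset.sum_congr rfl fun e _ => ?_
    rw [map_mul, map_pow, aeval_C, aeval_X, mul_left_comm, ← pow_succ', iteratedDeriv_zero]
    norm_cast
  · intro n hn
    have : cardinalBSpline (m + 1) n = 0 := by
      rcases le_or_gt n 0 with h | h
      · exact cardinalBSpline_succ_of_nonpos m (by exact_mod_cast h)
      · have hmn : (m : ℤ) + 2 ≤ n := by
          by_contra! hlt
          exact hn (Finset.mem_image.2 ⟨(n - 1).toNat, by simp; lia, by lia⟩)
        refine cardinalBSpline_of_ge (m + 1) ?_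
        push_cast
        rw [add_assoc, one_add_one_eq_two]
        exact_mod_cast hmn
    rw [this, Complex.ofReal_zero, zero_mul]

theorem exp_mul_aeval_eulerFrobenius_zero (m : ℕ) (θ : ℝ) :
    Complex.exp (Complex.I * θ) * aeval (Complex.exp (Complex.I * θ)) (eulerFrobenius (m + 1) 0)
      = ∑' n : ℤ, boxTransform (2 * Real.pi * n - θ) ^ (m + 2) := by
  rw [mul_aeval_eulerFrobenius_zero, tsum_cardinalBSpline_mul_exp_zpow]

theorem boxTransform_two_pi_mul_intCast (n : ℤ) :
    boxTransform (2 * Real.pi * n) = if n = 0 then 1 else 0 := by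
  split_ifs with hn
  · rw [hn, Int.cast_zero, mul_zero, boxTransform_zero]
  · have hexp : Complex.exp (-(Complex.I * (2 * Real.pi * n : ℝ))) = 1 :=
      Complex.exp_eq_one_iff.2 ⟨-n, by push_cast; ring⟩
    rw [boxTransform_of_ne_zero (by simp [hn, Real.pi_ne_zero]), hexp, sub_self, zero_div]

theorem aeval_one_eulerFrobenius_zero (m : ℕ) : aeval (1 : ℂ) (eulerFrobenius (m + 1) 0) = 1 := by
  have h := exp_mul_aeval_eulerFrobenius_zero m 0
  simp only [Complex.ofReal_zero, mul_zero, Complex.exp_zero, one_mul, sub_zero,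
    boxTransform_two_pi_mul_intCast] at h
  rw [h, tsum_eq_single 0 fun n hn => by simp [hn]]
  simp

theorem two_sub_two_mul_cos_mul_exp (θ : ℝ) :
    ((2 - 2 * Real.cos θ : ℝ) : ℂ) * Complex.exp (Complex.I * θ)
      = -(1 - Complex.exp (Complex.I * θ)) ^ 2 := by
  have h : Complex.exp (-θ * Complex.I) * Complex.exp (Complex.I * θ) = 1 := by
    rw [← Complex.exp_add, neg_mul, mul_comm Complex.I, neg_add_cancel, Complex.exp_zero]
  push_cast
  rw [Complex.two_cos, mul_comm (θ : ℂ) Complex.I]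
  linear_combination -h

theorem boxTransform_sq {θ : ℝ} {n : ℤ} (h : 2 * Real.pi * n - θ ≠ 0) :
    boxTransform (2 * Real.pi * n - θ) ^ 2 = Complex.exp (Complex.I * θ)
      * ((2 - 2 * Real.cos θ) / (2 * Real.pi * n - θ) ^ 2 : ℝ) := by
  have hexp : Complex.exp (-(Complex.I * (2 * Real.pi * n - θ : ℝ)))
      = Complex.exp (Complex.I * θ) :=
    Complex.exp_eq_exp_iff_exists_int.2 ⟨-n, by push_cast; ring⟩
  rw [boxTransform_of_ne_zero h, hexp, div_pow, mul_pow, Complex.I_sq, neg_one_mul, div_neg,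
    ← neg_div, ← two_sub_two_mul_cos_mul_exp]
  push_cast
  ring

theorem aeval_eulerFrobenius_zero_eq_tsum (r : ℕ) {θ : ℝ}
    (hθ : ∀ j : ℤ, θ + 2 * j * Real.pi ≠ 0) :
    aeval (Complex.exp (Complex.I * θ)) (eulerFrobenius (2 * r + 1) 0)
      = Complex.exp (Complex.I * θ) ^ r * (((2 - 2 * Real.cos θ) ^ (r + 1)
        * ∑' j : ℤ, 1 / (θ + 2 * j * Real.pi) ^ (2 * r + 2) : ℝ) : ℂ) := by
  refine mul_left_cancel₀ (Complex.exp_ne_zero (Complex.I * θ)) ?_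
  rw [exp_mul_aeval_eulerFrobenius_zero, ← (Equiv.neg ℤ).tsum_eq, ← mul_assoc, ← pow_succ',
    ← tsum_mul_left, Complex.ofReal_tsum, ← tsum_mul_left]
  congr 1 with j
  have hj : 2 * Real.pi * (-j : ℤ) - θ = -(θ + 2 * j * Real.pi) := by push_cast; ring
  rw [Equiv.neg_apply, show 2 * r + 2 = 2 * (r + 1) by ring, pow_mul,
    boxTransform_sq (by rw [hj]; exact neg_ne_zero.2 (hθ j)), hj, neg_sq]
  rw [mul_pow, mul_one_div, ← Complex.ofReal_pow, div_pow, ← pow_mul]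

/-! ### The symbols -/

theorem add_two_mul_int_mul_pi_ne_zero {θ : ℝ} (hθ : θ ∈ Icc (-Real.pi) Real.pi) (h0 : θ ≠ 0)
    (j : ℤ) : θ + 2 * j * Real.pi ≠ 0 := by
  intro h
  have hj : j ≠ 0 := by
    rintro rfl
    exact h0 (by simpa using h)
  have hj_abs : (1 : ℝ) ≤ |(j : ℝ)| := by exact_mod_cast Int.one_le_abs hj
  have hθ_abs : |θ| = 2 * |(j : ℝ)| * Real.pi := by
    rw [eq_neg_of_add_eq_zero_left h, abs_neg, abs_mul, abs_mul, abs_two, abs_of_pos Real.pi_pos]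
  have hθ_le : |θ| ≤ Real.pi := abs_le.2 hθ
  nlinarith [Real.pi_pos]

theorem exp_mul_symbolM (p : ℕ) {θ : ℝ} (hθ : θ ∈ Icc (-Real.pi) Real.pi) :
    Complex.exp (Complex.I * p * θ) * symbolM p θ
      = aeval (Complex.exp (Complex.I * θ)) (eulerFrobenius (2 * p + 1) 0) := by
  rw [symbolM]
  split_ifs with h
  · subst h
    simp [aeval_one_eulerFrobenius_zero]
  · rw [aeval_eulerFrobenius_zero_eq_tsum p (add_two_mul_int_mul_pi_ne_zero hθ h),
      ← Complex.exp_nat_mul, mul_left_comm (p : ℂ), mul_assoc]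

theorem exp_mul_symbolB {p : ℕ} (hp : 1 ≤ p) {θ : ℝ} (hθ : θ ∈ Icc (-Real.pi) Real.pi) :
    Complex.exp (Complex.I * p * θ) * symbolB p θ
      = aeval (Complex.exp (Complex.I * θ)) (eulerFrobenius (2 * p + 1) 2) := by
  obtain ⟨r, rfl⟩ := Nat.exists_eq_add_of_le' hp
  rw [show 2 * (r + 1) + 1 = 2 * r + 1 + 2 by ring, eulerFrobenius_add, map_mul, map_pow, map_sub,
    map_one, aeval_X, symbolB]
  split_ifs with h
  · subst h
    simp
  · rw [aeval_eulerFrobenius_zero_eq_tsum r (add_two_mul_int_mul_pi_ne_zero hθ h),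
      ← neg_neg ((1 - Complex.exp (Complex.I * θ)) ^ 2), ← two_sub_two_mul_cos_mul_exp,
      mul_right_comm Complex.I, mul_comm _ ((r + 1 : ℕ) : ℂ), Complex.exp_nat_mul,
      show 2 * (r + 1) = 2 * r + 2 by ring]
    push_cast
    ring

theorem exp_mul_symbolD (p : ℕ) (θ : ℝ) :
    Complex.exp (Complex.I * p * θ) * symbolD p θ
      = aeval (Complex.exp (Complex.I * θ)) (eulerFrobenius (2 * p + 1) (2 * p)) := by
  rw [add_comm, ← zero_add 1, eulerFrobenius_add, zero_add, eulerFrobenius_one_zero, mul_one,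
    map_pow, map_sub, map_one, aeval_X, pow_mul,
    ← neg_neg ((1 - Complex.exp (Complex.I * θ)) ^ 2), ← two_sub_two_mul_cos_mul_exp,
    ← neg_one_mul, mul_pow, mul_pow, mul_right_comm Complex.I, mul_comm _ (p : ℂ),
    Complex.exp_nat_mul, symbolD]
  push_cast
  ring

theorem splineSum_eq_of_exp_mul_eq_aeval {p k : ℕ} (hk : Even k) {θ : ℝ} {c : ℂ}
    (h : Complex.exp (Complex.I * p * θ) * c
      = aeval (Complex.exp (Complex.I * θ)) (eulerFrobenius (2 * p + 1) k)) :
    splineSum p k θ = c :=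
  mul_left_cancel₀ (Complex.exp_ne_zero _) ((aeval_eulerFrobenius_eq_splineSum hk p θ).symm.trans
    h.symm)

theorem splineSum_zero_eq_symbolM (p : ℕ) {θ : ℝ} (hθ : θ ∈ Icc (-Real.pi) Real.pi) :
    splineSum p 0 θ = symbolM p θ :=
  splineSum_eq_of_exp_mul_eq_aeval Even.zero (exp_mul_symbolM p hθ)

theorem splineSum_two_eq_symbolB {p : ℕ} (hp : 1 ≤ p) {θ : ℝ}
    (hθ : θ ∈ Icc (-Real.pi) Real.pi) : splineSum p 2 θ = symbolB p θ :=
  splineSum_eq_of_exp_mul_eq_aeval even_two (exp_mul_symbolB hp hθ)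

theorem splineSum_two_mul_eq_symbolD (p : ℕ) (θ : ℝ) : splineSum p (2 * p) θ = symbolD p θ :=
  splineSum_eq_of_exp_mul_eq_aeval (even_two_mul p) (exp_mul_symbolD p θ)

theorem continuous_splineSum (p k : ℕ) : Continuous (splineSum p k) := by
  unfold splineSum
  fun_prop

theorem continuousOn_of_splineSum_eq {p k : ℕ} {f : ℝ → ℝ} {S : Set ℝ}
    (h : ∀ θ ∈ S, splineSum p k θ = f θ) : ContinuousOn f S :=
  (Complex.continuous_re.comp (continuous_splineSum p k)).continuousOn.congr fun θ hθ => by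
    rw [Function.comp_apply, h θ hθ, Complex.ofReal_re]

theorem aeval_qPoly {p : ℕ} (hp : 1 ≤ p) (ρ δ : ℝ) {θ : ℝ} (hθ : θ ∈ Icc (-Real.pi) Real.pi) :
    aeval (Complex.exp (Complex.I * θ)) (qPoly p ρ δ) = Complex.exp (Complex.I * p * θ)
      * (symbolB p θ + ρ * (symbolM p θ + δ * (-1) ^ p * symbolD p θ)) := by
  simp only [qPoly_eq, map_add, map_mul, aeval_C, Complex.coe_algebraMap, ← exp_mul_symbolM p hθ,
    ← exp_mul_symbolB hp hθ, ← exp_mul_symbolD]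
  push_cast
  ring

/-! ### Galerkin matrices -/

theorem bspline_eq_zero_of_notMem (ξ : ℕ → ℝ) (k j : ℕ) {t : ℝ}
    (ht : t ∉ Ico (ξ j) (ξ (j + k + 1))) : bspline ξ k j t = 0 := by
  cases k <;> exact if_neg ht

theorem bspline_eq_cardinalBSpline {ξ : ℕ → ℝ} {h : ℝ} (hh : 0 < h) {k j : ℕ} {a : ℝ}
    (hξ : ∀ r ≤ k + 1, ξ (j + r) = h * (a + r)) (t : ℝ) :
    bspline ξ k j t = cardinalBSpline k (t / h - a) := by
  induction k generalizing j a with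
  | zero =>
    rw [bspline, cardinalBSpline, ← add_zero j, hξ 0 (by omega), add_zero j, hξ 1 (by omega),
      Nat.cast_zero, add_zero, Nat.cast_one]
    congr 1
    rw [sub_nonneg, le_div_iff₀ hh, sub_lt_iff_lt_add', div_lt_iff₀ hh, mul_comm h, mul_comm h]
  | succ k ih =>
    have left := ih (j := j) (a := a) fun r hr => hξ r (by omega)
    have right := ih (j := j + 1) (a := a + 1) fun r hr => by
      rw [add_assoc, hξ (1 + r) (by omega)]
      push_cast
      ring
    have knot_zero : ξ j = h * a := by simpa using hξ 0 (by omega)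
    have knot_one : ξ (j + 1) = h * (a + 1) := by simpa using hξ 1 (by omega)
    have knot_penultimate : ξ (j + k + 1) = h * (a + (k + 1)) := by
      simpa [add_assoc] using hξ (k + 1) (by omega)
    have knot_last : ξ (j + k + 2) = h * (a + (k + 2)) := by
      simpa [add_assoc] using hξ (k + 2) (by omega)
    have hk : (k : ℝ) + 1 ≠ 0 := by positivity
    rw [bspline, knot_last, knot_zero]
    split_ifs with ht
    · rw [left, right, cardinalBSpline_succ_apply, knot_one, knot_penultimate, sub_sub (t / h),
        show h * (a + (k + 1)) - h * a = h * (k + 1) by ring,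
        show h * (a + (k + 2)) - h * (a + 1) = h * (k + 1) by ring]
      congr 2 <;> field_simp
      ring
    · rw [not_and_or, not_le, not_lt] at ht
      rcases ht with ht | ht
      · refine (cardinalBSpline_of_neg _ ?_).symm
        rwa [sub_neg, div_lt_iff₀' hh]
      · refine (cardinalBSpline_of_ge _ ?_).symm
        push_cast
        rw [le_sub_iff_add_le', le_div_iff₀' hh, add_assoc, one_add_one_eq_two]
        exact ht

theorem iteratedDeriv_comp_mul_left {𝕜 E : Type*} [NontriviallyNormedField 𝕜]
    [NormedAddCommGroup E] [NormedSpace 𝕜 E] (k : ℕ) (f : 𝕜 → E) (c : 𝕜) :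
    iteratedDeriv k (fun t => f (c * t)) = fun t => c ^ k • iteratedDeriv k f (c * t) := by
  induction k with
  | zero => simp
  | succ k ih =>
    ext t
    rw [iteratedDeriv_succ, ih, deriv_fun_const_smul_field, deriv_comp_mul_left,
      ← iteratedDeriv_succ, smul_smul, ← pow_succ]

theorem support_iteratedDeriv_subset {𝕜 E : Type*} [NontriviallyNormedField 𝕜]
    [NormedAddCommGroup E] [NormedSpace 𝕜 E] (k : ℕ) (f : 𝕜 → E) :
    Function.support (iteratedDeriv k f) ⊆ tsupport f := by
  rw [iteratedDeriv_eq_equiv_comp]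
  exact (Function.support_comp_subset (map_zero _) _).trans (support_iteratedFDeriv_subset k)

theorem support_iteratedDeriv_splineBasis_subset (T : ℝ) (N p j k : ℕ) :
    Function.support (iteratedDeriv k (splineBasis T N p j))
      ⊆ Icc (knot T N p j) (knot T N p (j + p + 1)) :=
  (support_iteratedDeriv_subset k _).trans <| closure_minimal (fun t ht => by
    by_contra hmem
    exact ht (bspline_eq_zero_of_notMem _ _ _ fun h => hmem (Ico_subset_Icc_self h))) isClosed_Icc

theorem meshSize_pos {T : ℝ} (hT : 0 < T) {N : ℕ} (hN : 0 < N) : 0 < meshSize T N :=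
  div_pos hT (Nat.cast_pos.2 hN)

theorem knot_mono {T : ℝ} (hT : 0 ≤ T) (N p : ℕ) : Monotone (knot T N p) := fun a b hab =>
  mul_le_mul_of_nonneg_left
    (by exact_mod_cast min_le_min_right N (Nat.sub_le_sub_right hab p))
    (div_nonneg hT N.cast_nonneg)

theorem knot_le {T : ℝ} (hT : 0 ≤ T) (N p j : ℕ) : knot T N p j ≤ T :=
  calc knot T N p j ≤ meshSize T N * N :=
        mul_le_mul_of_nonneg_left (by exact_mod_cast min_le_right _ _)
          (div_nonneg hT N.cast_nonneg)
    _ ≤ T := mul_le_of_le_div₀ hT N.cast_nonneg le_rfl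

theorem iteratedDeriv_splineBasis {T : ℝ} (hT : 0 < T) {N p j : ℕ} (hj : p ≤ j)
    (hjN : j + 1 ≤ N) (k : ℕ) (t : ℝ) :
    iteratedDeriv k (splineBasis T N p j) t = (meshSize T N)⁻¹ ^ k
      * iteratedDeriv k (cardinalBSpline p) (t / meshSize T N - ((j : ℝ) - p)) := by
  have hcardinal : splineBasis T N p j
      = fun t => cardinalBSpline p ((meshSize T N)⁻¹ * t - ((j : ℝ) - p)) := by
    ext t
    rw [← div_eq_inv_mul]
    refine bspline_eq_cardinalBSpline (meshSize_pos hT (by omega)) (fun r hr => ?_) t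
    rw [knot, min_eq_left (by omega), Nat.cast_sub (by omega)]
    push_cast
    ring
  rw [hcardinal, iteratedDeriv_comp_mul_left k (fun s => cardinalBSpline p (s - ((j : ℝ) - p))),
    iteratedDeriv_comp_sub_const]
  simp only [smul_eq_mul, div_eq_inv_mul]

theorem iteratedDeriv_cardinalBSpline_ae_eq (k m : ℕ) :
    iteratedDeriv k (cardinalBSpline (m + k)) =ᵐ[volume] backwardDiff^[k] (cardinalBSpline m) := by
  filter_upwards [(countable_range ((↑) : ℤ → ℝ)).ae_notMem volume] with s hs
    using iteratedDeriv_cardinalBSpline_of_notMem k m hs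

theorem iteratedDeriv_cardinalBSpline_convolution (k l m n : ℕ) :
    iteratedDeriv k (cardinalBSpline (m + k)) ⋆ iteratedDeriv l (cardinalBSpline (n + l))
      = iteratedDeriv (k + l) (cardinalBSpline (m + n + 1 + (k + l))) := by
  rw [convolution_congr _ (iteratedDeriv_cardinalBSpline_ae_eq k m)
    (iteratedDeriv_cardinalBSpline_ae_eq l n),
    backwardDiff_iterate_convolution (convolutionExists_cardinalBSpline m n),
    cardinalBSpline_convolution_cardinalBSpline, iteratedDeriv_cardinalBSpline]

theorem integral_iteratedDeriv_cardinalBSpline_mul {p k : ℕ} (hp : 1 ≤ p) (hk : k ≤ p) (y : ℝ) :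
    ∫ t, iteratedDeriv k (cardinalBSpline p) (t - y) * iteratedDeriv k (cardinalBSpline p) t
      = (-1) ^ k * iteratedDeriv (2 * k) (cardinalBSpline (2 * p + 1)) ((p : ℝ) + 1 + y) := by
  have hreflect (t : ℝ) : iteratedDeriv k (cardinalBSpline p) (t - y)
      = (-1) ^ k * iteratedDeriv k (cardinalBSpline p) ((p : ℝ) + 1 + y - t) := by
    obtain ⟨r, rfl⟩ := Nat.exists_eq_add_of_le' hp
    rw [← iteratedDeriv_cardinalBSpline_succ_sub_self]
    congr 1
    push_cast
    ring
  obtain ⟨m, rfl⟩ := Nat.exists_eq_add_of_le' hk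
  rw [show 2 * (m + k) + 1 = m + m + 1 + (k + k) by ring, two_mul k,
    ← iteratedDeriv_cardinalBSpline_convolution, convolution_lsmul, ← integral_const_mul]
  congr 1 with t
  rw [hreflect, smul_eq_mul]
  ring

theorem galerkinMatrix_apply_eq_integral {T : ℝ} (hT : 0 < T) {N p : ℕ} (k : ℕ)
    (i j : Fin (N + p - 1)) (hi : p < i) :
    galerkinMatrix T N p k i j = ∫ t, iteratedDeriv k (splineBasis T N p ((j : ℕ) + 1)) t
      * iteratedDeriv k (splineBasis T N p (i : ℕ)) t := by
  refine intervalIntegral.integral_eq_integral_of_support_subset <|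
    (Function.support_mul_subset_right _ _).trans <|
      (support_iteratedDeriv_splineBasis_subset T N p i k).trans fun t ht =>
        ⟨lt_of_lt_of_le ?_ ht.1, ht.2.trans (knot_le hT.le _ _ _)⟩
  refine mul_pos (meshSize_pos hT (by omega)) (Nat.cast_pos.2 ?_)
  rw [lt_min_iff]
  omega

theorem galerkinMatrix_apply_of_mem_band {T : ℝ} (hT : 0 < T) {N p k : ℕ} (hp : 1 ≤ p)
    (hk : k ≤ p) (i j : Fin (N + p - 1)) (hi : 2 * p ≤ (i : ℕ)) (hiN : (i : ℕ) + p + 1 ≤ N)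
    {e : ℕ} (he : e ≤ 2 * p) (hij : (i : ℕ) + e = (j : ℕ) + p + 1) :
    galerkinMatrix T N p k i j = meshSize T N * (meshSize T N)⁻¹ ^ (2 * k)
      * ((-1) ^ k * iteratedDeriv (2 * k) (cardinalBSpline (2 * p + 1)) ((e : ℝ) + 1)) := by
  set h := meshSize T N
  have hh : 0 < h := meshSize_pos hT (by omega)
  set Ψ : ℝ → ℝ := iteratedDeriv k (cardinalBSpline p)
  set a : ℝ := i - p
  have hrow (t : ℝ) : iteratedDeriv k (splineBasis T N p (i : ℕ)) t = h⁻¹ ^ k * Ψ (t / h - a) :=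
    iteratedDeriv_splineBasis hT (by omega) (by omega) k t
  have hcol (t : ℝ) : iteratedDeriv k (splineBasis T N p ((j : ℕ) + 1)) t
      = h⁻¹ ^ k * Ψ (t / h - a - (e - p)) := by
    have hij' : ((i : ℕ) : ℝ) + e = (j : ℕ) + p + 1 := by exact_mod_cast hij
    rw [iteratedDeriv_splineBasis hT (by omega) (by omega), sub_sub]
    push_cast
    congr 3
    linear_combination -hij'
  calc galerkinMatrix T N p k i j
      = h⁻¹ ^ (2 * k) * ∫ t, Ψ (t / h - a - (e - p)) * Ψ (t / h - a) := by
        rw [galerkinMatrix_apply_eq_integral hT k i j (by omega), ← integral_const_mul]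
        congr 1 with t
        rw [hcol, hrow]
        ring
    _ = h⁻¹ ^ (2 * k) * (h * ∫ s, Ψ (s - (e - p)) * Ψ s) := by
        rw [Measure.integral_comp_div (fun s => Ψ (s - a - (e - p)) * Ψ (s - a)),
          integral_sub_right_eq_self (fun s => Ψ (s - (e - p)) * Ψ s), abs_of_pos hh, smul_eq_mul]
    _ = _ := by
        rw [integral_iteratedDeriv_cardinalBSpline_mul hp hk]
        ring_nf

theorem galerkinMatrix_apply_of_notMem_band {T : ℝ} (hT : 0 ≤ T) {N p : ℕ} (k : ℕ)
    (i j : Fin (N + p - 1))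
    (hij : (i : ℕ) + p + 1 ≤ (j : ℕ) + 1 ∨ (j : ℕ) + 1 + p + 1 ≤ (i : ℕ)) :
    galerkinMatrix T N p k i j = 0 := by
  have hne : ∀ᵐ t : ℝ, t ∉ ({knot T N p i, knot T N p (j + 1)} : Set ℝ) :=
    (((Set.finite_singleton _).insert _).countable).ae_notMem volume
  refine intervalIntegral.integral_zero_ae ?_
  filter_upwards [hne] with t ht _
  simp only [mem_insert_iff, mem_singleton_iff, not_or] at ht
  by_contra hmul
  have hrow := support_iteratedDeriv_splineBasis_subset T N p i k (right_ne_zero_of_mul hmul)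
  have hcol := support_iteratedDeriv_splineBasis_subset T N p (j + 1) k (left_ne_zero_of_mul hmul)
  rcases hij with h | h
  · exact ht.2 (le_antisymm (hrow.2.trans (knot_mono hT N p h)) hcol.1)
  · exact ht.1 (le_antisymm (hcol.2.trans (knot_mono hT N p h)) hrow.1)

/-- The Galerkin matrix of the derivatives of order `k`, with the sign `(-1)^k` from `k`
integrations by parts and rescaled to unit mesh size, so that its Toeplitz band does not depend on
`T` and `N`. -/
noncomputable def scaledGalerkinMatrix (T : ℝ) (N p k : ℕ) :
    Matrix (Fin (N + p - 1)) (Fin (N + p - 1)) ℝ :=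
  ((-1) ^ k * meshSize T N ^ (2 * k) * (meshSize T N)⁻¹) • galerkinMatrix T N p k

theorem isAssociatedPolynomial_eulerFrobenius {T : ℝ} (hT : 0 < T) {p k : ℕ} (hp : 1 ≤ p)
    (hk : k ≤ p) :
    IsAssociatedPolynomial p (fun N => scaledGalerkinMatrix T N p k)
      (eulerFrobenius (2 * p + 1) (2 * k)) := by
  have hdeg := natDegree_eulerFrobenius_succ_le (2 * p) (2 * k)
  refine ⟨hdeg, fun N i j hi hiN => ?_⟩
  have hh : meshSize T N ≠ 0 := (meshSize_pos hT (by omega)).ne'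
  simp only [scaledGalerkinMatrix, Matrix.smul_apply, smul_eq_mul]
  by_cases hband : (i : ℕ) ≤ j + p + 1 ∧ (j : ℕ) + p + 1 - i ≤ 2 * p
  · obtain ⟨e, he⟩ := Nat.exists_eq_add_of_le hband.1
    rw [if_pos hband.1, he, Nat.add_sub_cancel_left, coeff_eulerFrobenius (by omega),
      galerkinMatrix_apply_of_mem_band hT hp hk i j hi hiN (by omega) he.symm, inv_pow]
    field_simp
    rw [← pow_mul, mul_comm k 2, pow_mul, neg_one_sq, one_pow, one_mul]
  · rw [galerkinMatrix_apply_of_notMem_band hT.le k i j (by omega), mul_zero, eq_comm,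
      ite_eq_right_iff]
    exact fun hle => coeff_eq_zero_of_natDegree_lt (hdeg.trans_lt (by omega))

section IsAssociatedPolynomial

variable {p : ℕ} {A B : ∀ N : ℕ, Matrix (Fin (N + p - 1)) (Fin (N + p - 1)) ℝ} {q r : ℝ[X]}

theorem IsAssociatedPolynomial.add (hA : IsAssociatedPolynomial p A q)
    (hB : IsAssociatedPolynomial p B r) : IsAssociatedPolynomial p (A + B) (q + r) := by
  refine ⟨(natDegree_add_le q r).trans (max_le hA.1 hB.1), fun N i j hi hiN => ?_⟩
  rw [Pi.add_apply, Matrix.add_apply, hA.2 N i j hi hiN, hB.2 N i j hi hiN, ite_add_ite, add_zero,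
    coeff_add]

theorem IsAssociatedPolynomial.smul (c : ℝ) (hA : IsAssociatedPolynomial p A q) :
    IsAssociatedPolynomial p (c • A) (C c * q) := by
  refine ⟨(natDegree_C_mul_le c q).trans hA.1, fun N i j hi hiN => ?_⟩
  rw [Pi.smul_apply, Matrix.smul_apply, hA.2 N i j hi hiN, smul_ite, smul_zero, smul_eq_mul,
    coeff_C_mul]

end IsAssociatedPolynomial

theorem scaledSystemMatrix_eq (T : ℝ) (N p : ℕ) (ρ δ : ℝ) :
    scaledSystemMatrix T N p ρ δ = scaledGalerkinMatrix T N p 1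
      + ρ • (scaledGalerkinMatrix T N p 0
        + (δ * (-1) ^ p) • scaledGalerkinMatrix T N p p) := by
  have hsign : ((-1 : ℝ) ^ p) ^ 2 = 1 := by rw [← pow_mul, mul_comm, pow_mul, neg_one_sq, one_pow]
  ext i j
  simp only [scaledSystemMatrix, systemMatrix, massMatrix, stiffnessMatrix, penaltyMatrix,
    scaledGalerkinMatrix, Matrix.smul_apply, Matrix.add_apply, Matrix.neg_apply, smul_eq_mul]
  rcases eq_or_ne (meshSize T N) 0 with h | h
  · simp only [h, inv_zero, mul_zero, zero_mul, add_zero]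
  · field_simp
    linear_combination (-ρ * δ * meshSize T N ^ (2 * p) * galerkinMatrix T N p p i j) * hsign

theorem isAssociatedPolynomial_qPoly {T : ℝ} (hT : 0 < T) {p : ℕ} (hp : 1 ≤ p) (ρ δ : ℝ) :
    IsAssociatedPolynomial p (fun N => scaledSystemMatrix T N p ρ δ) (qPoly p ρ δ) := by
  simp only [scaledSystemMatrix_eq, qPoly_eq]
  exact (isAssociatedPolynomial_eulerFrobenius hT hp hp).add
    (((isAssociatedPolynomial_eulerFrobenius hT hp (Nat.zero_le p)).add
      ((isAssociatedPolynomial_eulerFrobenius hT hp le_rfl).smul (δ * (-1) ^ p))).smul ρ)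

end SplineSymbol

theorem proposition5p1 (p : ℕ) (hp : 1 ≤ p) :
    -- the series converge off `0`, and the values at `0` are the continuous extensions
    (∀ θ ∈ Set.Icc (-Real.pi) Real.pi, θ ≠ 0 →
      Summable (fun j : ℤ => 1 / (θ + 2 * j * Real.pi) ^ (2 * p + 2)) ∧
      Summable (fun j : ℤ => 1 / (θ + 2 * j * Real.pi) ^ (2 * p))) ∧
    ContinuousOn (SplineSymbol.symbolM p) (Set.Icc (-Real.pi) Real.pi) ∧
    ContinuousOn (SplineSymbol.symbolB p) (Set.Icc (-Real.pi) Real.pi) ∧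
    -- the three relations
    (∀ θ ∈ Set.Icc (-Real.pi) Real.pi,
      SplineSymbol.splineSum p 0 θ = (SplineSymbol.symbolM p θ : ℂ) ∧
      SplineSymbol.splineSum p 2 θ = (SplineSymbol.symbolB p θ : ℂ) ∧
      SplineSymbol.splineSum p (2 * p) θ = (SplineSymbol.symbolD p θ : ℂ)) ∧
    -- the polynomial of the Toeplitz band part of the scaled system matrices
    ∀ ρ δ : ℝ,
      (∀ T : ℝ, 0 < T →
        SplineSymbol.IsAssociatedPolynomial p
          (fun N => SplineSymbol.scaledSystemMatrix T N p ρ δ) (SplineSymbol.qPoly p ρ δ)) ∧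
      ∀ θ ∈ Set.Icc (-Real.pi) Real.pi,
        Polynomial.aeval (Complex.exp (Complex.I * θ)) (SplineSymbol.qPoly p ρ δ) =
          Complex.exp (Complex.I * p * θ) *
            ((SplineSymbol.symbolB p θ : ℂ) + (ρ : ℂ) * ((SplineSymbol.symbolM p θ : ℂ)
              + (δ : ℂ) * (-1) ^ p * (SplineSymbol.symbolD p θ : ℂ))) := by
  have hM (θ : ℝ) (hθ : θ ∈ Set.Icc (-Real.pi) Real.pi) :=
    SplineSymbol.splineSum_zero_eq_symbolM p hθ
  have hB (θ : ℝ) (hθ : θ ∈ Set.Icc (-Real.pi) Real.pi) :=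
    SplineSymbol.splineSum_two_eq_symbolB hp hθ
  have hD (θ : ℝ) := SplineSymbol.splineSum_two_mul_eq_symbolD p θ
  have hsummable (θ : ℝ) {k : ℕ} (hk : 2 ≤ k) :=
    SplineSymbol.summable_one_div_add_two_mul_int_mul_pi_pow θ hk
  exact ⟨fun θ _ _ => ⟨hsummable θ (by omega), hsummable θ (by omega)⟩,
    SplineSymbol.continuousOn_of_splineSum_eq hM, SplineSymbol.continuousOn_of_splineSum_eq hB,
    fun θ hθ => ⟨hM θ hθ, hB θ hθ, hD θ⟩,
    fun ρ δ => ⟨fun _ hT => SplineSymbol.isAssociatedPolynomial_qPoly hT hp ρ δ,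
      fun _ hθ => SplineSymbol.aeval_qPoly hp ρ δ hθ⟩⟩
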